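/- Let $p$ be a prime, $l\ge 1$, $q=p^l$, and let $k\ge 1$ and $n\ge 2$ be integers. Put $d=\gcd(k,q-1)$. The set of all finite sums of $k$-th powers of elements of $\mathbb F_q$ is a subfield $\mathbb F_{p^{\ell}}$ of $\mathbb F_q$; this defines the divisor $\ell$ of $l$. Let $P=\{A^k+B^k \mid A,B\in M_n(\mathbb F_q)\}$. Suppose that $\ell=l$ and $p\nmid k$. (a) Suppose $q\ge 3d+1$. If $d=2$, or if $d>2$ and $$n>\max\left\{\frac{d-1}{2},\ \frac{4\ln(k-1)}{\ln q}\right\},$$ then $P=M_n(\mathbb F_q)$. (b) Suppose $q=2d+1$. If $d=2$, or if $d>2$ and $$n>\max\left\{2d-1,\ \frac{4\ln(k-1)}{\ln q}\right\},$$ then $P=M_n(\mathbb F_q)$. -/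

import Mathlib

/-- The `s`-fold sumset `sT = {x₁ + ⋯ + xₛ | x₁, …, xₛ ∈ T}`. -/
def sumset {S : Type*} [AddCommMonoid S] (s : ℕ) (T : Set S) : Set S :=
  {x | ∃ f : Fin s → S, (∀ i, f i ∈ T) ∧ ∑ i, f i = x}

/-- The set `{a ^ k | a ∈ R}` of `k`-th powers of `R`; it is used both for the field `F`
and for the ring of `n × n` matrices over `F`. -/
def kPowers (k : ℕ) (R : Type*) [Monoid R] : Set R :=
  {x | ∃ a : R, a ^ k = x}

/-- The set `P` of the `n × n` matrices over `F` that are sums of two `k`-th powers. -/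
def twoPowerSums (k n : ℕ) (F : Type*) [Field F] : Set (Matrix (Fin n) (Fin n) F) :=
  sumset 2 (kPowers k (Matrix (Fin n) (Fin n) F))

/-- `ℓ` is the exponent for which the set of all finite sums of `k`-th powers in the finite field
`F` of characteristic `p` is the subfield of `F` with `p ^ ℓ` elements. -/
def IsPowerSumExponent (p k : ℕ) (F : Type*) [Field F] (ℓ : ℕ) : Prop :=
  ∃ K : Subfield F, Nat.card K = p ^ ℓ ∧ (⋃ s ≥ 1, sumset s (kPowers k F)) = (K : Set F)

/-!
Let `q` be the cardinality of `F`. A scalar `c` is a sum of two `k`-th powers of elements of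
`𝔽_{q^r}` as soon as `(gcd (k, q ^ r - 1) - 1) ^ 4 < q ^ r`, by expanding the number of solutions in
Jacobi sums; letting `𝔽_{q^r}` act on `F ^ n` for some `r ∣ n` turns such a representation into one
by matrices.

A nonscalar matrix is similar to one with any prescribed diagonal of the same trace, and so to a sum
of an upper and a lower triangular matrix with prescribed diagonals. A triangular matrix whose
diagonal consists of `k`-th powers, at most one of them zero, is a `k`-th power when `k ≠ 0` in `F`:
Lagrange interpolation with Newton lifting at multiple roots gives a polynomial `g` such that
`g ^ k ≡ X` modulo the characteristic polynomial. Every nonscalar matrix is thus a sum of two `k`-th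
powers once each element of `F` is a sum of `2n` `k`-th powers, of which at most one in each half
vanishes.

The nonzero `k`-th powers are the roots of unity of order `m = (q - 1) / d`. If `m ≥ 2`, a set that
stops growing when they are added to it is invariant under all translations, so it is all of `F`.
If `m ≥ 3`, a union of orbits of roots of unity even gains a whole nonzero orbit at each step before
it fills `F`, because the first and the second power sum of such a union vanish; hence every nonzero
element is a sum of `d` roots of unity. Either the sums of two `k`-th powers already form three
nonzero orbits, so that `-1`, and then `0`, is reached in time, or `0` is a sum of two or three
roots of unity.
-/

section JacobiSum

open Finset

variable {K R : Type*} [Field K] [CommRing R]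

theorem mulChar_pow_apply (χ : MulChar K R) (i : ℕ) {u : K} (hu : u ≠ 0) :
    (χ ^ i) u = χ u ^ i :=
  χ.pow_apply_coe i (Units.mk0 u hu)

theorem exists_pow_orderOf_eq_of_mulChar_eq_one [Finite K] {χ : MulChar K R} {u : K} (hu : u ≠ 0)
    (h : χ u = 1) : ∃ a : K, a ^ orderOf χ = u := by
  obtain ⟨g, hg⟩ := IsCyclic.exists_generator (α := Kˣ)
  obtain ⟨a, ha⟩ := mem_powers_iff_mem_zpowers.mpr (hg (Units.mk0 u hu))
  have hau : (g : K) ^ a = u := congrArg Units.val ha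
  have hχa : χ ^ a = 1 := by
    rw [MulChar.eq_iff hg, MulChar.pow_apply_coe, ← map_pow, hau, h, MulChar.one_apply_coe]
  obtain ⟨c, rfl⟩ := orderOf_dvd_of_pow_eq_one hχa
  exact ⟨(g : K) ^ c, by rw [← hau, ← pow_mul, mul_comm]⟩

theorem sum_mulChar_pow_eq_zero [Finite K] [IsDomain R] {χ : MulChar K R} {u : K}
    (hu : ∀ a, a ^ orderOf χ ≠ u) : ∑ i ∈ range (orderOf χ), (χ ^ i) u = 0 := by
  rcases eq_or_ne u 0 with rfl | hu0
  · exact sum_eq_zero fun i _ ↦ MulChar.map_zero _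
  have hχu : χ u - 1 ≠ 0 := fun h ↦
    (exists_pow_orderOf_eq_of_mulChar_eq_one hu0 (sub_eq_zero.mp h)).elim hu
  refine eq_zero_of_ne_zero_of_mul_right_eq_zero hχu ?_
  rw [sum_congr rfl fun i _ ↦ mulChar_pow_apply χ i hu0, geom_sum_mul,
    ← mulChar_pow_apply χ _ hu0, pow_orderOf_eq_one, MulChar.one_apply hu0.isUnit, sub_self]

theorem norm_mulChar_apply [Finite K] (χ : MulChar K ℂ) {u : K} (hu : u ≠ 0) : ‖χ u‖ = 1 := by
  have := Fintype.ofFinite K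
  refine Complex.norm_eq_one_of_pow_eq_one (n := Fintype.card K - 1) ?_
    (Nat.sub_pos_of_lt Fintype.one_lt_card).ne'
  rw [← map_pow, FiniteField.pow_card_sub_one_eq_one u hu, map_one]

variable [Fintype K]

theorem sum_mulChar_mul_mulChar_sub (χ φ : MulChar K R) {c : K} (hc : c ≠ 0) :
    ∑ x, χ x * φ (c - x) = (χ * φ) c * jacobiSum χ φ := by
  rw [jacobiSum, mul_sum, ← Equiv.sum_comp (Equiv.mulLeft₀ c hc)]
  refine sum_congr rfl fun x _ ↦ ?_
  rw [Equiv.mulLeft₀_apply, show c - c * x = c * (1 - x) by ring, map_mul, map_mul,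
    MulChar.mul_apply]
  ring

theorem sum_mulChar_pow_mul_sum_mulChar_pow_sub [IsDomain R] {χ : MulChar K R}
    (hχ : 0 < orderOf χ) {c : K} (hc : c ≠ 0) :
    ∑ x, (∑ i ∈ range (orderOf χ), (χ ^ i) x) * ∑ j ∈ range (orderOf χ), (χ ^ j) (c - x) =
      Fintype.card K - 2 * ∑ i ∈ range (orderOf χ), (χ ^ i) c +
        ∑ i ∈ Ico 1 (orderOf χ), ∑ j ∈ Ico 1 (orderOf χ),
          (χ ^ i * χ ^ j) c * jacobiSum (χ ^ i) (χ ^ j) := by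
  have hexpand : ∑ x, (∑ i ∈ range (orderOf χ), (χ ^ i) x) *
        ∑ j ∈ range (orderOf χ), (χ ^ j) (c - x) =
      ∑ i ∈ range (orderOf χ), ∑ j ∈ range (orderOf χ),
        (χ ^ i * χ ^ j) c * jacobiSum (χ ^ i) (χ ^ j) := by
    simp_rw [sum_mul_sum, ← sum_mulChar_mul_mulChar_sub _ _ hc]
    rw [sum_comm]
    exact sum_congr rfl fun i _ ↦ sum_comm
  have hone : (1 : MulChar K R) c = 1 := MulChar.one_apply hc.isUnit
  have hrow : ∑ j ∈ Ico 1 (orderOf χ), (χ ^ j) c * jacobiSum 1 (χ ^ j) =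
      -∑ j ∈ Ico 1 (orderOf χ), (χ ^ j) c := by
    rw [← sum_neg_distrib]
    refine sum_congr rfl fun j hj ↦ ?_
    obtain ⟨hj1, hjχ⟩ := mem_Ico.mp hj
    rw [jacobiSum_one_nontrivial (pow_ne_one_of_lt_orderOf (by lia) hjχ), mul_neg_one]
  have hcol : ∑ i ∈ Ico 1 (orderOf χ), (χ ^ i) c * jacobiSum (χ ^ i) 1 =
      -∑ i ∈ Ico 1 (orderOf χ), (χ ^ i) c := by
    simpa only [jacobiSum_comm _ (1 : MulChar K R)] using hrow
  rw [hexpand]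
  simp only [sum_range_eq_add_Ico _ hχ, pow_zero, one_mul, mul_one, sum_add_distrib, hrow,
    hcol, hone, jacobiSum_one_one]
  ring

theorem star_jacobiSum (χ φ : MulChar K ℂ) : star (jacobiSum χ φ) = jacobiSum χ⁻¹ φ⁻¹ := by
  simp only [jacobiSum, star_sum, star_mul', MulChar.star_apply']

theorem norm_jacobiSum_le {χ φ : MulChar K ℂ} (hχ : χ ≠ 1) (hφ : φ ≠ 1) :
    ‖jacobiSum χ φ‖ ≤ √(Fintype.card K) := by
  by_cases h : χ * φ = 1
  · obtain rfl : φ = χ⁻¹ := eq_inv_of_mul_eq_one_right h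
    rw [jacobiSum_nontrivial_inv hχ, norm_neg, norm_mulChar_apply χ (neg_ne_zero.mpr one_ne_zero)]
    exact Real.one_le_sqrt.mpr (by exact_mod_cast Fintype.card_pos)
  · have hchar : ringChar ℂ ≠ ringChar K := by
      rw [ringChar.eq_zero]
      exact (CharP.ringChar_ne_zero_of_finite K).symm
    have hmul := jacobiSum_mul_jacobiSum_inv hchar hχ hφ h
    rw [← star_jacobiSum, ← starRingEnd_apply, Complex.mul_conj'] at hmul
    refine Real.le_sqrt_of_sq_le (le_of_eq ?_)
    exact_mod_cast hmul

theorem norm_sum_sum_mulChar_mul_jacobiSum_le (χ : MulChar K ℂ) {c : K} (hc : c ≠ 0) :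
    ‖∑ i ∈ Ico 1 (orderOf χ), ∑ j ∈ Ico 1 (orderOf χ),
        (χ ^ i * χ ^ j) c * jacobiSum (χ ^ i) (χ ^ j)‖ ≤
      ((orderOf χ - 1 : ℕ) : ℝ) ^ 2 * √(Fintype.card K) := by
  have hne {i : ℕ} (hi : i ∈ Ico 1 (orderOf χ)) : χ ^ i ≠ 1 := by
    obtain ⟨hi1, hiχ⟩ := mem_Ico.mp hi
    exact pow_ne_one_of_lt_orderOf (by lia) hiχ
  calc _ ≤ ∑ _i ∈ Ico 1 (orderOf χ), ∑ _j ∈ Ico 1 (orderOf χ), √(Fintype.card K) := by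
        refine norm_sum_le_of_le _ fun _ hi ↦ norm_sum_le_of_le _ fun j hj ↦ ?_
        rw [norm_mul, norm_mulChar_apply _ hc, one_mul]
        exact norm_jacobiSum_le (hne hi) (hne hj)
    _ = _ := by
        simp only [sum_const, Nat.card_Ico, nsmul_eq_mul]
        ring

theorem exists_pow_add_pow_of_dvd_card_sub_one {K : Type*} [Field K] [Finite K] {e : ℕ}
    (he : e ∣ Nat.card K - 1) (hcard : (e - 1) ^ 4 < Nat.card K) (c : K) :
    ∃ a b : K, a ^ e + b ^ e = c := by
  have := Fintype.ofFinite K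
  rw [Nat.card_eq_fintype_card] at he hcard
  have he0 : e ≠ 0 := ne_zero_of_dvd_ne_zero (Nat.sub_pos_of_lt Fintype.one_lt_card).ne' he
  by_cases hc : ∃ a : K, a ^ e = c
  · obtain ⟨a, rfl⟩ := hc
    exact ⟨a, 0, by rw [zero_pow he0, add_zero]⟩
  push Not at hc
  have hc0 : c ≠ 0 := fun h ↦ hc 0 (by rw [zero_pow he0, h])
  obtain ⟨χ, rfl⟩ := MulChar.exists_mulChar_orderOf K he (Complex.isPrimitiveRoot_exp e he0)
  by_contra! hne
  have hconv : ∑ x, (∑ i ∈ range (orderOf χ), (χ ^ i) x) *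
      ∑ j ∈ range (orderOf χ), (χ ^ j) (c - x) = 0 := by
    refine sum_eq_zero fun x _ ↦ ?_
    by_cases hx : ∃ a : K, a ^ orderOf χ = x
    · obtain ⟨a, rfl⟩ := hx
      rw [sum_mulChar_pow_eq_zero (u := c - _) fun b hb ↦ hne a b (by rw [hb]; ring), mul_zero]
    · rw [sum_mulChar_pow_eq_zero (not_exists.mp hx), zero_mul]
  rw [sum_mulChar_pow_mul_sum_mulChar_pow_sub (Nat.pos_of_ne_zero he0) hc0,
    sum_mulChar_pow_eq_zero hc, mul_zero, sub_zero] at hconv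
  have hle : (Fintype.card K : ℝ) ≤ ((orderOf χ - 1 : ℕ) : ℝ) ^ 2 * √(Fintype.card K) := by
    have := norm_sum_sum_mulChar_mul_jacobiSum_le χ hc0
    rwa [← neg_eq_of_add_eq_zero_right hconv, norm_neg, Complex.norm_natCast] at this
  have hsqrt : √(Fintype.card K) ≤ ((orderOf χ - 1 : ℕ) : ℝ) ^ 2 := by
    have hpos : (0 : ℝ) < Fintype.card K := by exact_mod_cast Fintype.card_pos
    refine le_of_mul_le_mul_right ?_ (Real.sqrt_pos.mpr hpos)
    rwa [Real.mul_self_sqrt (Nat.cast_nonneg _)]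
  have hcard' : (Fintype.card K : ℝ) ≤ ((orderOf χ - 1 : ℕ) : ℝ) ^ 4 := by
    rw [show 4 = 2 * 2 from rfl, pow_mul]
    exact (Real.sqrt_le_left (by positivity)).mp hsqrt
  exact absurd hcard (not_lt.mpr (by exact_mod_cast hcard'))

end JacobiSum

section PowersInFiniteFields

variable {K : Type*} [Field K]

theorem exists_pow_eq_pow_gcd_card_sub_one {k : ℕ} (hk : k ≠ 0) (a : K) :
    ∃ b : K, b ^ k = a ^ k.gcd (Nat.card K - 1) := by
  rcases eq_or_ne a 0 with rfl | ha
  · exact ⟨0, by rw [zero_pow hk, zero_pow (Nat.gcd_ne_zero_left hk)]⟩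
  lift a to Kˣ using ha.isUnit
  refine ⟨(a ^ k.gcdA (Nat.card K - 1) : Kˣ), ?_⟩
  norm_cast
  rw [← zpow_natCast a (k.gcd _), Nat.gcd_eq_gcd_ab, zpow_add,
    zpow_mul a ((Nat.card K - 1 : ℕ) : ℤ), zpow_natCast, ← Nat.card_units, pow_card_eq_one',
    one_zpow, mul_one, mul_comm, zpow_mul, zpow_natCast]

theorem exists_pow_add_pow_of_gcd_lt_card [Finite K] {k : ℕ} (hk : k ≠ 0)
    (hcard : (k.gcd (Nat.card K - 1) - 1) ^ 4 < Nat.card K) (c : K) :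
    ∃ a b : K, a ^ k + b ^ k = c := by
  obtain ⟨a, b, hab⟩ := exists_pow_add_pow_of_dvd_card_sub_one (k.gcd_dvd_right _) hcard c
  obtain ⟨a', ha⟩ := exists_pow_eq_pow_gcd_card_sub_one hk a
  obtain ⟨b', hb⟩ := exists_pow_eq_pow_gcd_card_sub_one hk b
  exact ⟨a', b', by rw [ha, hb, hab]⟩

/- Multiplication by elements of the extension of degree `r`, acting on a direct power of it. -/
theorem exists_pow_add_pow_eq_scalar_of_dvd {F : Type*} [Field F] [Finite F] {k n r : ℕ}
    (hk : k ≠ 0) (hn : n ≠ 0) (hr : r ∣ n)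
    (hcard : (k.gcd (Nat.card F ^ r - 1) - 1) ^ 4 < Nat.card F ^ r) (c : F) :
    ∃ A B : Matrix (Fin n) (Fin n) F, A ^ k + B ^ k = Matrix.scalar (Fin n) c := by
  obtain ⟨p, hp⟩ := CharP.exists F
  have : Fact p.Prime := ⟨CharP.char_is_prime F p⟩
  obtain ⟨s, rfl⟩ := hr
  have : NeZero r := ⟨left_ne_zero_of_mul hn⟩
  let K := FiniteField.Extension F p r
  obtain ⟨a, b, hab⟩ := exists_pow_add_pow_of_gcd_lt_card (K := K) hk
    (by rwa [FiniteField.natCard_extension]) (algebraMap F K c)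
  have hrank : Module.finrank F (Fin s → K) = r * s := by
    rw [Module.finrank_pi_fintype]
    simp [K, FiniteField.finrank_extension, mul_comm]
  let φ : K →ₐ[F] Matrix (Fin (r * s)) (Fin (r * s)) F :=
    (LinearMap.toMatrixAlgEquiv (Module.finBasisOfFinrankEq F _ hrank)).toAlgHom.comp
      (Algebra.lsmul F F (Fin s → K))
  exact ⟨φ a, φ b, by rw [← map_pow, ← map_pow, ← map_add, hab, AlgHom.commutes]; rfl⟩

end PowersInFiniteFields

section ConjugationToPrescribedDiagonal

open Matrix

variable {F ι : Type*} [Field F] [Fintype ι] [DecidableEq ι]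

theorem isConj_transvection_mul_mul_transvection {i j : ι} (hij : i ≠ j) (c : F)
    (M : Matrix ι ι F) : IsConj M (transvection i j c * M * transvection i j (-c)) := by
  have hinv (a : F) : transvection i j a * transvection i j (-a) = 1 := by
    rw [transvection_mul_transvection_same _ _ hij, add_neg_cancel, transvection_zero]
  have hinv' : transvection i j (-c) * transvection i j c = 1 := by
    simpa only [neg_neg] using hinv (-c)
  refine ⟨⟨transvection i j c, transvection i j (-c), hinv c, hinv'⟩, ?_⟩
  rw [SemiconjBy, mul_assoc _ (transvection i j (-c)), hinv', mul_one]

theorem transvection_mul_mul_transvection_apply_self {i j x : ι} (hi : x ≠ i) (hj : x ≠ j) (c : F)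
    (M : Matrix ι ι F) : (transvection i j c * M * transvection i j (-c)) x x = M x x := by
  rw [mul_transvection_apply_of_ne _ _ _ _ hj, transvection_mul_apply_of_ne _ _ _ _ hi]

theorem exists_isConj_apply_self_eq {M : Matrix ι ι F} {i j : ι} (hij : i ≠ j) (hM : M j i ≠ 0)
    (c : F) : ∃ N, IsConj M N ∧ N i i = c ∧ N j i ≠ 0 ∧ ∀ x, x ≠ i → x ≠ j → N x x = M x x := by
  refine ⟨_, isConj_transvection_mul_mul_transvection hij ((c - M i i) / M j i) M, ?_, ?_,
    fun x hi hj ↦ transvection_mul_mul_transvection_apply_self hi hj _ M⟩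
  · rw [mul_transvection_apply_of_ne _ _ _ _ hij, transvection_mul_apply_same,
      div_mul_cancel₀ _ hM, add_sub_cancel]
  · rwa [mul_transvection_apply_of_ne _ _ _ _ hij, transvection_mul_apply_of_ne _ _ _ _ hij.symm]

theorem exists_isConj_apply_ne_zero_of_col_eq_zero {M : Matrix ι ι F} {i j k : ι} (hji : j ≠ i)
    (hki : k ≠ i) (hM : M j i ≠ 0) (hMk : M k i = 0) :
    ∃ N, IsConj M N ∧ N j k ≠ 0 ∧ ∀ x, x ≠ k → N x x = M x x := by
  by_cases hMjk : M j k = 0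
  · refine ⟨_, isConj_transvection_mul_mul_transvection hki.symm 1 M, ?_, fun x hx ↦ ?_⟩
    · rw [mul_transvection_apply_same, transvection_mul_apply_of_ne _ _ _ _ hji,
        transvection_mul_apply_of_ne _ _ _ _ hji, hMjk, zero_add, neg_one_mul]
      exact neg_ne_zero.mpr hM
    · rcases eq_or_ne x i with rfl | hxi
      · rw [mul_transvection_apply_of_ne _ _ _ _ hx, transvection_mul_apply_same, hMk, mul_zero,
          add_zero]
      · exact transvection_mul_mul_transvection_apply_self hxi hx 1 M
  · exact ⟨M, IsConj.refl M, hMjk, fun _ _ ↦ rfl⟩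

theorem exists_isConj_apply_ne_zero {M : Matrix ι ι F} {i j k : ι} (hji : j ≠ i) (hki : k ≠ i)
    (hkj : k ≠ j) (hM : M j i ≠ 0) :
    ∃ N, IsConj M N ∧ N j k ≠ 0 ∧ ∀ x, x ≠ j → x ≠ k → N x x = M x x := by
  obtain ⟨c, hc⟩ : ∃ c, c * M j i = -M k i := ⟨-M k i / M j i, div_mul_cancel₀ _ hM⟩
  have hMk : (transvection k j c * M * transvection k j (-c)) k i = 0 := by
    rw [mul_transvection_apply_of_ne _ _ _ _ hji.symm, transvection_mul_apply_same, hc,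
      add_neg_cancel]
  have hMj : (transvection k j c * M * transvection k j (-c)) j i ≠ 0 := by
    rwa [mul_transvection_apply_of_ne _ _ _ _ hji.symm,
      transvection_mul_apply_of_ne _ _ _ _ hkj.symm]
  obtain ⟨N, hconj, hN, hdiag⟩ := exists_isConj_apply_ne_zero_of_col_eq_zero hji hki hMj hMk
  exact ⟨N, (isConj_transvection_mul_mul_transvection hkj _ M).trans hconj, hN, fun x hj hk ↦
    (hdiag x hk).trans (transvection_mul_mul_transvection_apply_self hk hj _ M)⟩

/- A nonzero off-diagonal entry `(j, i)` allows one to prescribe the entry `(i, i)`; afterwards the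
nonzero entry is moved within row `j` to the next column to be treated. -/
theorem exists_isConj_forall_mem_apply_self_eq (γ : ι → F) (j : ι) (s : Finset ι) (hj : j ∉ s)
    {M : Matrix ι ι F} {i : ι} (hi : i ∈ s) (hM : M j i ≠ 0) :
    ∃ N, IsConj M N ∧ (∀ x ∈ s, N x x = γ x) ∧ ∀ x ∉ s, x ≠ j → N x x = M x x := by
  induction s using Finset.eraseInduction generalizing M i with
  | H s ih =>
  have hij : i ≠ j := ne_of_mem_of_not_mem hi hj
  obtain ⟨M₁, hconj₁, hγ₁, hM₁, hdiag₁⟩ := exists_isConj_apply_self_eq hij hM (γ i)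
  rcases (s.erase i).eq_empty_or_nonempty with hs | ⟨k, hk⟩
  · refine ⟨M₁, hconj₁, fun x hx ↦ ?_, fun x hx ↦ hdiag₁ x (ne_of_mem_of_not_mem hi hx).symm⟩
    rcases (Finset.erase_eq_empty_iff s i).mp hs with rfl | rfl
    · exact absurd hi (Finset.notMem_empty i)
    · rwa [Finset.mem_singleton.mp hx]
  · have hks := Finset.mem_of_mem_erase hk
    obtain ⟨M₂, hconj₂, hM₂, hdiag₂⟩ := exists_isConj_apply_ne_zero hij.symm
      (Finset.ne_of_mem_erase hk) (ne_of_mem_of_not_mem hks hj) hM₁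
    obtain ⟨N, hconj, hγ, hdiag⟩ := ih i hi (fun h ↦ hj (Finset.mem_of_mem_erase h)) hk hM₂
    refine ⟨N, (hconj₁.trans hconj₂).trans hconj, fun x hx ↦ ?_, fun x hx hxj ↦ ?_⟩
    · rcases eq_or_ne x i with rfl | hxi
      · rw [hdiag x (s.notMem_erase x) hij, hdiag₂ x hij (Finset.ne_of_mem_erase hk).symm, hγ₁]
      · exact hγ x (Finset.mem_erase.mpr ⟨hxi, hx⟩)
    · rw [hdiag x (fun h ↦ hx (Finset.mem_of_mem_erase h)) hxj,
        hdiag₂ x hxj (ne_of_mem_of_not_mem hks hx).symm,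
        hdiag₁ x (ne_of_mem_of_not_mem hi hx).symm hxj]

theorem exists_isConj_exists_apply_ne_zero {M : Matrix ι ι F} (hM : ∀ c, M ≠ scalar ι c) :
    ∃ N, IsConj M N ∧ ∃ i j, i ≠ j ∧ N j i ≠ 0 := by
  by_cases! hdiag : ∃ i j, i ≠ j ∧ M j i ≠ 0
  · exact ⟨M, IsConj.refl M, hdiag⟩
  obtain ⟨i, j, hij⟩ : ∃ i j, M i i ≠ M j j := by
    by_contra! heq
    rcases isEmpty_or_nonempty ι with hι | ⟨⟨i⟩⟩
    · exact hM 0 (Subsingleton.elim _ _)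
    · refine hM (M i i) (Matrix.ext fun a b ↦ ?_)
      rcases eq_or_ne a b with rfl | hab
      · rw [scalar_apply, diagonal_apply_eq, heq]
      · rw [hdiag b a hab.symm, scalar_apply, diagonal_apply_ne _ hab]
  have hne : i ≠ j := fun h ↦ hij (by rw [h])
  refine ⟨_, isConj_transvection_mul_mul_transvection hne 1 M, j, i, hne.symm, ?_⟩
  rw [mul_transvection_apply_same, transvection_mul_apply_same, transvection_mul_apply_same,
    hdiag j i hne.symm, hdiag i j hne]
  intro h
  exact hij (by linear_combination -h)

theorem trace_eq_of_isConj {M N : Matrix ι ι F} (h : IsConj M N) : M.trace = N.trace := by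
  obtain ⟨P, hP⟩ := h
  rw [(P.eq_mul_inv_iff_mul_eq).mpr hP.eq.symm, trace_units_conj]

theorem exists_isConj_forall_apply_self_eq {M : Matrix ι ι F} (hM : ∀ c, M ≠ scalar ι c)
    {γ : ι → F} (hγ : ∑ i, γ i = M.trace) : ∃ N, IsConj M N ∧ ∀ i, N i i = γ i := by
  obtain ⟨M', hconj', i, j, hij, hM'⟩ := exists_isConj_exists_apply_ne_zero hM
  obtain ⟨N, hconj, hN, -⟩ := exists_isConj_forall_mem_apply_self_eq γ j (Finset.univ.erase j)
    (Finset.notMem_erase j _) (Finset.mem_erase.mpr ⟨hij, Finset.mem_univ i⟩) hM'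
  have hoff (x : ι) (hx : x ≠ j) : N x x = γ x :=
    hN x (Finset.mem_erase.mpr ⟨hx, Finset.mem_univ x⟩)
  refine ⟨N, hconj'.trans hconj, fun x ↦ ?_⟩
  rcases eq_or_ne x j with rfl | hx
  · have htrace : ∑ i, N i i = ∑ i, γ i := by
      rw [hγ, trace_eq_of_isConj (hconj'.trans hconj)]
      rfl
    rw [← Finset.add_sum_erase _ _ (Finset.mem_univ x),
      ← Finset.add_sum_erase _ γ (Finset.mem_univ x),
      Finset.sum_congr rfl fun y hy ↦ hoff y (Finset.ne_of_mem_erase hy)] at htrace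
    exact add_right_cancel htrace
  · exact hoff x hx

end ConjugationToPrescribedDiagonal

section PowerRoots

open Polynomial

variable {F : Type*} [Field F] {k : ℕ}

theorem exists_X_sub_C_mul_dvd_pow_sub_X_of_eval_ne_zero {N f : F[X]} (hf : N ∣ f ^ k - X) {b : F}
    (hN : N.eval (b ^ k) ≠ 0) : ∃ g : F[X], (X - C (b ^ k)) * N ∣ g ^ k - X := by
  let g := f + C ((b - f.eval (b ^ k)) / N.eval (b ^ k)) * N
  have hroot : X - C (b ^ k) ∣ g ^ k - X := by
    rw [dvd_iff_isRoot, IsRoot]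
    simp [g, hN]
  have hfg : N ∣ g ^ k - f ^ k :=
    (dvd_mul_left N _).trans (add_sub_cancel_left f _ ▸ sub_dvd_pow_sub_pow g f k)
  refine ⟨g, IsCoprime.mul_dvd ?_ hroot (by simpa using dvd_add hfg hf)⟩
  rwa [(irreducible_X_sub_C _).coprime_iff_not_dvd, dvd_iff_isRoot]

theorem exists_X_sub_C_mul_dvd_pow_sub_X_of_ne_zero (hk : (k : F) ≠ 0) {N f : F[X]}
    (hf : N ∣ f ^ k - X) {b : F} (hb : b ≠ 0) :
    ∃ g : F[X], (X - C (b ^ k)) * N ∣ g ^ k - X := by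
  by_cases! hN : N.eval (b ^ k) ≠ 0
  · exact exists_X_sub_C_mul_dvd_pow_sub_X_of_eval_ne_zero hf hN
  obtain ⟨h, hh⟩ := hf
  have hfb : f.eval (b ^ k) ^ k = b ^ k := by
    have := congrArg (eval (b ^ k)) hh
    rw [eval_sub, eval_pow, eval_X, eval_mul, hN, zero_mul] at this
    exact sub_eq_zero.mp this
  have hk0 : k ≠ 0 := by
    rintro rfl
    exact hk Nat.cast_zero
  have hfb0 : f.eval (b ^ k) ≠ 0 := ne_zero_pow hk0 (by rw [hfb]; exact pow_ne_zero k hb)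
  have hderiv : (k : F) * f.eval (b ^ k) ^ (k - 1) ≠ 0 := mul_ne_zero hk (pow_ne_zero _ hfb0)
  -- One Newton step `f + t N` with a constant `t` raises the multiplicity of the root `b ^ k`.
  let t := -h.eval (b ^ k) / (k * f.eval (b ^ k) ^ (k - 1))
  obtain ⟨r, hr⟩ := powAddExpansion f (C t * N) k
  have hroot : X - C (b ^ k) ∣ h + (k : F[X]) * f ^ (k - 1) * C t + r * C t ^ 2 * N := by
    rw [dvd_iff_isRoot, IsRoot]
    simp only [eval_add, eval_mul, eval_natCast, eval_pow, eval_C, hN, mul_zero, add_zero, t,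
      mul_div_cancel₀ _ hderiv, add_neg_cancel]
  have hfactor : (f + C t * N) ^ k - X =
      (h + (k : F[X]) * f ^ (k - 1) * C t + r * C t ^ 2 * N) * N := by
    rw [hr]
    linear_combination hh
  exact ⟨f + C t * N, hfactor ▸ mul_dvd_mul_right hroot N⟩

theorem exists_prod_X_sub_C_dvd_pow_sub_X {ι : Type*} (hk : (k : F) ≠ 0) {b : ι → F}
    (hb : {i | b i = 0}.Subsingleton) (s : Finset ι) :
    ∃ g : F[X], (∏ i ∈ s, (X - C (b i ^ k))) ∣ g ^ k - X := by
  classical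
  induction s using Finset.induction_on with
  | empty => exact ⟨0, by rw [Finset.prod_empty]; exact one_dvd _⟩
  | insert i s hi ih =>
    obtain ⟨f, hf⟩ := ih
    rw [Finset.prod_insert hi]
    by_cases! hbi : b i ≠ 0
    · exact exists_X_sub_C_mul_dvd_pow_sub_X_of_ne_zero hk hf hbi
    · refine exists_X_sub_C_mul_dvd_pow_sub_X_of_eval_ne_zero hf ?_
      rw [eval_prod, Finset.prod_ne_zero_iff]
      intro j hj h
      have hk0 : k ≠ 0 := by
        rintro rfl
        exact hk Nat.cast_zero
      have hbj : b j = 0 := by simpa [hbi, hk0] using h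
      exact hi (hb hbj hbi ▸ hj)

open Matrix

variable {ι : Type*} [Fintype ι] [DecidableEq ι]

theorem exists_pow_eq_of_isUpperTriangular [LinearOrder ι] (hk : (k : F) ≠ 0) {M : Matrix ι ι F}
    (hM : M.IsUpperTriangular) {b : ι → F} (hb : {i | b i = 0}.Subsingleton)
    (hdiag : ∀ i, M i i = b i ^ k) : ∃ A : Matrix ι ι F, A ^ k = M := by
  obtain ⟨g, hg⟩ := exists_prod_X_sub_C_dvd_pow_sub_X hk hb Finset.univ
  have hchar : M.charpoly ∣ g ^ k - X := by
    simpa only [charpoly_of_isUpperTriangular M hM, hdiag] using hg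
  refine ⟨aeval M g, sub_eq_zero.mp ?_⟩
  rw [← map_pow]
  nth_rewrite 2 [← aeval_X (R := F) M]
  rw [← map_sub]
  exact aeval_eq_zero_of_dvd_aeval_eq_zero hchar (aeval_self_charpoly M)

theorem exists_pow_add_pow_eq_of_apply_self_eq [LinearOrder ι] (hk : (k : F) ≠ 0)
    {M : Matrix ι ι F} {a b : ι → F} (ha : {i | a i = 0}.Subsingleton)
    (hb : {i | b i = 0}.Subsingleton) (hdiag : ∀ i, M i i = a i ^ k + b i ^ k) :
    ∃ A B : Matrix ι ι F, A ^ k + B ^ k = M := by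
  let U : Matrix ι ι F := of fun i j ↦ if i = j then a i ^ k else if i < j then M i j else 0
  let L : Matrix ι ι F := of fun i j ↦ if i = j then b i ^ k else if i < j then 0 else M i j
  have hUL : U + L = M := by
    ext i j
    simp only [U, L, Matrix.add_apply, of_apply]
    split_ifs with hij hlt
    · rw [← hij, hdiag]
    · rw [add_zero]
    · rw [zero_add]
  have hU : U.IsUpperTriangular := fun i j (hij : j < i) ↦ by simp [U, hij.ne', hij.not_gt]
  have hL : Lᵀ.IsUpperTriangular := fun i j (hij : j < i) ↦ by simp [L, hij.ne, hij]
  obtain ⟨A, hA⟩ := exists_pow_eq_of_isUpperTriangular hk hU ha fun i ↦ by simp [U]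
  obtain ⟨B, hB⟩ := exists_pow_eq_of_isUpperTriangular hk hL hb fun i ↦ by simp [L]
  exact ⟨A, Bᵀ, by rw [← transpose_pow, hA, hB, transpose_transpose, hUL]⟩

theorem exists_pow_add_pow_eq_of_trace_eq [LinearOrder ι] (hk : (k : F) ≠ 0) {M : Matrix ι ι F}
    (hM : ∀ c, M ≠ scalar ι c) {a b : ι → F} (ha : {i | a i = 0}.Subsingleton)
    (hb : {i | b i = 0}.Subsingleton) (htrace : ∑ i, a i ^ k + ∑ i, b i ^ k = M.trace) :
    ∃ A B : Matrix ι ι F, A ^ k + B ^ k = M := by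
  obtain ⟨N, hconj, hN⟩ := exists_isConj_forall_apply_self_eq hM
    (Finset.sum_add_distrib.trans htrace)
  obtain ⟨A, B, hAB⟩ := exists_pow_add_pow_eq_of_apply_self_eq hk ha hb hN
  obtain ⟨P, hP⟩ := hconj.symm
  refine ⟨P * A * (P⁻¹ : (Matrix ι ι F)ˣ), P * B * (P⁻¹ : (Matrix ι ι F)ˣ), ?_⟩
  rw [P.conj_pow, P.conj_pow, ← add_mul, ← mul_add, hAB, Units.mul_inv_eq_iff_eq_mul]
  exact hP.eq

end PowerRoots

section SumsetGrowth

open Finset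
open scoped Pointwise

variable {F : Type*} [Field F] [DecidableEq F]

/-- The `m`-th roots of unity of a field, as a finite set. A finite set `T` is a union of orbits
of their multiplicative action when `unityRoots F m * T ⊆ T`. -/
noncomputable abbrev unityRoots (F : Type*) [Field F] (m : ℕ) : Finset F :=
  Polynomial.nthRootsFinset m 1

variable {m : ℕ} {ζ : F} {T U : Finset F}

theorem unityRoots_mul_self_subset : unityRoots F m * unityRoots F m ⊆ unityRoots F m :=
  mul_subset_iff.mpr fun _ hx _ hy ↦ by
    simpa only [mul_one] using Polynomial.mul_mem_nthRootsFinset hx hy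

theorem unityRoots_mul_insert_zero_subset (hT : unityRoots F m * T ⊆ T) :
    unityRoots F m * insert 0 T ⊆ insert 0 T := by
  simp only [mul_subset_iff, mem_insert] at hT ⊢
  rintro h hh t (rfl | ht)
  · exact Or.inl (mul_zero h)
  · exact Or.inr (hT h hh t ht)

theorem unityRoots_mul_add_subset (hT : unityRoots F m * T ⊆ T) (hU : unityRoots F m * U ⊆ U) :
    unityRoots F m * (T + U) ⊆ T + U :=
  (mul_add_subset _ _ _).trans (add_subset_add hT hU)

theorem unityRoots_mul_add_nsmul_subset (hT : unityRoots F m * T ⊆ T) (s : ℕ) :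
    unityRoots F m * (T + s • unityRoots F m) ⊆ T + s • unityRoots F m := by
  induction s with
  | zero => rwa [zero_nsmul, add_zero]
  | succ s ih =>
    rw [succ_nsmul, ← add_assoc]
    exact unityRoots_mul_add_subset ih unityRoots_mul_self_subset

theorem sum_pow_eq_zero_of_unityRoots_mul_subset [NeZero m] (hζ : IsPrimitiveRoot ζ m)
    (hT : unityRoots F m * T ⊆ T) {i : ℕ} (hi : ¬ m ∣ i) : ∑ t ∈ T, t ^ i = 0 := by
  have hmaps : Set.MapsTo (ζ * ·) (T : Set F) T := fun t ht ↦
    hT (mul_mem_mul (hζ.mem_nthRootsFinset (NeZero.pos m)) ht)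
  have hinj : Set.InjOn (ζ * ·) (T : Set F) :=
    (mul_right_injective₀ (hζ.ne_zero (NeZero.ne m))).injOn
  have hsum : ∑ t ∈ T, (ζ * t) ^ i = ∑ t ∈ T, t ^ i :=
    sum_nbij (ζ * ·) hmaps hinj (surjOn_of_injOn_of_card_le _ hmaps hinj le_rfl) fun _ _ ↦ rfl
  simp_rw [mul_pow, ← mul_sum] at hsum
  exact eq_zero_of_mul_eq_self_left (mt (hζ.pow_eq_one_iff_dvd i).mp hi) hsum

theorem card_erase_zero_eq_card_image_pow_mul [NeZero m] (hζ : IsPrimitiveRoot ζ m)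
    (hT : unityRoots F m * T ⊆ T) : #(T.erase 0) = #((T.erase 0).image (· ^ m)) * m := by
  rw [card_eq_sum_card_image (· ^ m)]
  refine sum_const_nat fun z hz ↦ ?_
  obtain ⟨y, hy, rfl⟩ := mem_image.mp hz
  obtain ⟨hy0, hyT⟩ := mem_erase.mp hy
  have hfiber : {x ∈ T.erase 0 | x ^ m = y ^ m} = (unityRoots F m).image (· * y) := by
    ext x
    simp only [mem_filter, mem_image, mem_erase, Polynomial.mem_nthRootsFinset (NeZero.pos m)]
    constructor
    · rintro ⟨-, hx⟩
      exact ⟨x / y, by rw [div_pow, hx, div_self (pow_ne_zero _ hy0)], div_mul_cancel₀ _ hy0⟩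
    · rintro ⟨h, hh, rfl⟩
      have hmem : h ∈ unityRoots F m := (Polynomial.mem_nthRootsFinset (NeZero.pos m) 1).mpr hh
      exact ⟨⟨mul_ne_zero (Polynomial.ne_zero_of_mem_nthRootsFinset one_ne_zero hmem) hy0,
        hT (mul_mem_mul hmem hyT)⟩, by rw [mul_pow, hh, one_mul]⟩
  rw [hfiber, card_image_of_injective _ (mul_left_injective₀ hy0), hζ.card_nthRootsFinset]

section Stagnation

variable [Fintype F] {H : Finset F}

theorem eq_univ_of_card_add_le (hζ : ζ ≠ 1) (hH : ∀ h ∈ H, ζ * h ∈ H)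
    (hgen : AddSubmonoid.closure (H : Set F) = ⊤) (hT : T.Nonempty) (hcard : #(T + H) ≤ #T) :
    T = univ := by
  have htranslate {h : F} (hh : h ∈ H) : T + {h} = T + H :=
    eq_of_subset_of_card_le (add_subset_add_left (singleton_subset_iff.mpr hh))
      (by rwa [card_add_singleton])
  have hperiod (v : F) : ∀ t ∈ T, t + (ζ - 1) * v ∈ T := by
    have hv : v ∈ AddSubmonoid.closure (H : Set F) := hgen ▸ AddSubmonoid.mem_top v
    induction hv using AddSubmonoid.closure_induction with
    | mem h hh =>
      intro t ht
      have hmem : t + ζ * h ∈ T + {h} := htranslate hh ▸ add_mem_add ht (hH h hh)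
      obtain ⟨u, hu, _, huh, htu⟩ := mem_add.mp hmem
      rw [mem_singleton.mp huh] at htu
      rwa [show t + (ζ - 1) * h = u by linear_combination -htu]
    | zero => simp
    | add v w _ _ hv hw =>
      intro t ht
      rw [mul_add, ← add_assoc]
      exact hw _ (hv t ht)
  obtain ⟨t, ht⟩ := hT
  refine eq_univ_of_forall fun x ↦ ?_
  have hx := hperiod ((x - t) / (ζ - 1)) t ht
  rwa [mul_div_cancel₀ _ (sub_ne_zero.mpr hζ), add_sub_cancel] at hx

theorem min_card_add_le_card_add_nsmul (hζ : ζ ≠ 1) (hH : ∀ h ∈ H, ζ * h ∈ H)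
    (hgen : AddSubmonoid.closure (H : Set F) = ⊤) (hT : T.Nonempty) (s : ℕ) :
    min (#T + s) (Fintype.card F) ≤ #(T + s • H) := by
  have hHne : H.Nonempty := by
    by_contra h
    rw [not_nonempty_iff_eq_empty.mp h, coe_empty, AddSubmonoid.closure_empty] at hgen
    exact bot_ne_top hgen
  induction s with
  | zero => simp
  | succ s ih =>
    rw [succ_nsmul, ← add_assoc T]
    rcases le_or_gt #(T + s • H + H) #(T + s • H) with hstag | hgrow
    · have huniv := eq_univ_of_card_add_le hζ hH hgen (hT.add hHne.nsmul) hstag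
      calc min (#T + (s + 1)) (Fintype.card F) ≤ #(T + s • H) := by
            rw [huniv, card_univ]; exact min_le_right _ _
        _ ≤ #(T + s • H + H) := card_le_card_add_right hHne
    · omega

end Stagnation

-- Comparing first and second power sums: those of a union of orbits vanish.
theorem eq_zero_or_eq_one_of_unityRoots_mul_insert_subset [NeZero m] (hζ : IsPrimitiveRoot ζ m)
    (hm : 3 ≤ m) (hT : unityRoots F m * T ⊆ T) {f : F} (hf : f ∉ T.image (· + 1))
    (hR : unityRoots F m * insert f (T.image (· + 1)) ⊆ insert f (T.image (· + 1))) :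
    f = 0 ∨ f = 1 := by
  have hdvd {i : ℕ} (hi : 0 < i) (him : i < m) : ¬ m ∣ i := Nat.not_dvd_of_pos_of_lt hi him
  have hsum (i : ℕ) :
      ∑ y ∈ insert f (T.image (· + 1)), y ^ i = f ^ i + ∑ t ∈ T, (t + 1) ^ i := by
    rw [sum_insert hf, sum_image (add_left_injective (1 : F)).injOn]
  have hT1 := sum_pow_eq_zero_of_unityRoots_mul_subset hζ hT (hdvd one_pos (by lia))
  have hT2 := sum_pow_eq_zero_of_unityRoots_mul_subset hζ hT (hdvd two_pos (by lia))
  have hR1 := sum_pow_eq_zero_of_unityRoots_mul_subset hζ hR (hdvd one_pos (by lia))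
  have hR2 := sum_pow_eq_zero_of_unityRoots_mul_subset hζ hR (hdvd two_pos (by lia))
  rw [hsum] at hR1 hR2
  simp only [pow_one, add_sq, sum_add_distrib, sum_const, nsmul_eq_mul, mul_one, one_pow]
    at hT1 hR1 hR2
  rw [← mul_sum] at hR2
  have hff : f * (f - 1) = 0 := by linear_combination hR2 - hT2 - hT1 - hR1
  exact (mul_eq_zero.mp hff).imp_right sub_eq_zero.mp

theorem insert_zero_add_subset_of_card_add_eq_succ [NeZero m] (hζ : IsPrimitiveRoot ζ m)
    (hm : 3 ≤ m) (hT : unityRoots F m * T ⊆ T) (hzero : 0 ∈ T + unityRoots F m)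
    (hcard : #(T + unityRoots F m) = #T + 1) :
    insert 0 T + unityRoots F m ⊆ T + unityRoots F m := by
  have hmpos := NeZero.pos m
  have hone : (1 : F) ∈ unityRoots F m := Polynomial.one_mem_nthRootsFinset hmpos
  have hR := unityRoots_mul_add_subset hT (unityRoots_mul_self_subset (F := F) (m := m))
  have hsub : T.image (· + 1) ⊆ T + unityRoots F m := image_subset_iff.mpr fun _ ht ↦
    add_mem_add ht hone
  obtain ⟨f, hf, hinsert⟩ := (exists_eq_insert_iff (s := T.image (· + 1))).mpr
    ⟨hsub, by rw [card_image_of_injective _ (add_left_injective 1), hcard]⟩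
  have hf0 : f ≠ 0 := by
    rintro rfl
    obtain ⟨t, ht, h, hh, hth⟩ := mem_add.mp hzero
    have hh0 : h ≠ 0 := Polynomial.ne_zero_of_mem_nthRootsFinset one_ne_zero hh
    have hinv : h⁻¹ ∈ unityRoots F m := by
      rw [Polynomial.mem_nthRootsFinset hmpos] at hh ⊢
      rw [inv_pow, hh, inv_one]
    refine hf (mem_image.mpr ⟨h⁻¹ * t, hT (mul_mem_mul hinv ht), ?_⟩)
    rw [eq_neg_of_add_eq_zero_left hth, mul_neg, inv_mul_cancel₀ hh0, neg_add_cancel]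
  have hf1 : f = 1 := (eq_zero_or_eq_one_of_unityRoots_mul_insert_subset hζ hm hT hf
    (hinsert ▸ hR)).resolve_left hf0
  have honeR : (1 : F) ∈ T + unityRoots F m := hinsert ▸ hf1 ▸ mem_insert_self f _
  refine add_subset_iff.mpr fun t ht h hh ↦ ?_
  rcases mem_insert.mp ht with rfl | ht
  · simpa only [mul_one, zero_add] using hR (mul_mem_mul hh honeR)
  · exact add_mem_add ht hh

variable [Fintype F]

theorem add_unityRoots_eq_univ_of_card_add_eq_succ [NeZero m] (hζ : IsPrimitiveRoot ζ m)
    (hm : 3 ≤ m) (hgen : AddSubmonoid.closure (unityRoots F m : Set F) = ⊤)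
    (hT : unityRoots F m * T ⊆ T) (hzeroT : 0 ∉ T) (hzero : 0 ∈ T + unityRoots F m)
    (hcard : #(T + unityRoots F m) = #T + 1) : T + unityRoots F m = univ := by
  have hsub := insert_zero_add_subset_of_card_add_eq_succ hζ hm hT hzero hcard
  have hinsert : insert 0 T = univ := by
    refine eq_univ_of_card_add_le (hζ.ne_one (by lia)) (fun h hh ↦ ?_) hgen
      (insert_nonempty 0 T) ((card_le_card hsub).trans ?_)
    · exact unityRoots_mul_self_subset
        (mul_mem_mul (hζ.mem_nthRootsFinset (NeZero.pos m)) hh)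
    · rw [hcard, card_insert_of_notMem hzeroT]
  rw [← card_eq_iff_eq_univ, hcard, ← card_insert_of_notMem hzeroT, hinsert, card_univ]

theorem add_unityRoots_eq_univ_or_card_erase_zero_add_le [NeZero m] (hζ : IsPrimitiveRoot ζ m)
    (hm : 3 ≤ m) (hgen : AddSubmonoid.closure (unityRoots F m : Set F) = ⊤)
    (hT : unityRoots F m * T ⊆ T) (hne : T.Nonempty) :
    T + unityRoots F m = univ ∨ #(T.erase 0) + m ≤ #((T + unityRoots F m).erase 0) := by
  by_contra! ⟨huniv, hlt⟩
  have hζmem := hζ.mem_nthRootsFinset (NeZero.pos m)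
  have hrootsne : (unityRoots F m).Nonempty := ⟨ζ, hζmem⟩
  have hle : #((T + unityRoots F m).erase 0) ≤ #(T.erase 0) := by
    rw [card_erase_zero_eq_card_image_pow_mul hζ hT, card_erase_zero_eq_card_image_pow_mul hζ
      (unityRoots_mul_add_subset hT unityRoots_mul_self_subset)] at hlt ⊢
    rw [← Nat.succ_mul] at hlt
    exact Nat.mul_le_mul_right m (Nat.lt_succ_iff.mp (lt_of_mul_lt_mul_right hlt (Nat.zero_le m)))
  have hgrow : #T < #(T + unityRoots F m) := by
    by_contra! hstag
    have hTuniv := eq_univ_of_card_add_le (hζ.ne_one (by lia))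
      (fun h hh ↦ unityRoots_mul_self_subset (mul_mem_mul hζmem hh)) hgen hne hstag
    exact huniv ((card_eq_iff_eq_univ _).mp (le_antisymm (card_le_univ _)
      (card_univ (α := F) ▸ hTuniv ▸ card_le_card_add_right hrootsne)))
  -- A set whose nonzero part does not grow can only have acquired the element zero.
  have hzero : 0 ∈ T + unityRoots F m := by
    by_contra h
    rw [erase_eq_of_notMem h] at hle
    exact absurd (hle.trans (card_erase_le (s := T))) hgrow.not_ge
  have hzeroT : 0 ∉ T := fun h ↦ by
    have := card_erase_add_one h
    have := card_erase_add_one hzero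
    lia
  rw [erase_eq_of_notMem hzeroT] at hle
  have hcard : #(T + unityRoots F m) = #T + 1 := by
    have := card_erase_add_one hzero
    lia
  exact huniv (add_unityRoots_eq_univ_of_card_add_eq_succ hζ hm hgen hT hzeroT hzero hcard)

theorem min_mul_le_card_erase_zero_add_nsmul [NeZero m] (hζ : IsPrimitiveRoot ζ m)
    (hm : 3 ≤ m) (hgen : AddSubmonoid.closure (unityRoots F m : Set F) = ⊤)
    (hT : unityRoots F m * T ⊆ T) (hne : T.Nonempty) {c d : ℕ} (hd : Fintype.card F = m * d + 1)
    (hc : c * m ≤ #(T.erase 0)) (s : ℕ) :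
    min (c + s) d * m ≤ #((T + s • unityRoots F m).erase 0) := by
  have hrootsne : (unityRoots F m).Nonempty := ⟨ζ, hζ.mem_nthRootsFinset (NeZero.pos m)⟩
  induction s with
  | zero =>
    rw [zero_nsmul, add_zero, add_zero]
    exact (Nat.mul_le_mul_right m (min_le_left c d)).trans hc
  | succ s ih =>
    rw [succ_nsmul, ← add_assoc T]
    rcases add_unityRoots_eq_univ_or_card_erase_zero_add_le hζ hm hgen
      (unityRoots_mul_add_nsmul_subset hT s) (hne.add hrootsne.nsmul) with huniv | hgrow
    · rw [huniv, card_erase_of_mem (mem_univ _), card_univ, hd, Nat.add_sub_cancel, mul_comm]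
      exact Nat.mul_le_mul_left m (min_le_right _ _)
    · calc min (c + (s + 1)) d * m ≤ (min (c + s) d + 1) * m := Nat.mul_le_mul_right m (by lia)
        _ = min (c + s) d * m + m := by ring
        _ ≤ _ := by lia

theorem mem_add_nsmul_unityRoots_of_ne_zero [NeZero m] (hζ : IsPrimitiveRoot ζ m)
    (hm : 3 ≤ m) (hgen : AddSubmonoid.closure (unityRoots F m : Set F) = ⊤)
    (hT : unityRoots F m * T ⊆ T) (hne : T.Nonempty) {c d s : ℕ}
    (hd : Fintype.card F = m * d + 1) (hc : c * m ≤ #(T.erase 0)) (hs : d ≤ c + s)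
    {x : F} (hx : x ≠ 0) : x ∈ T + s • unityRoots F m := by
  have hcard := min_mul_le_card_erase_zero_add_nsmul hζ hm hgen hT hne hd hc s
  rw [min_eq_right hs] at hcard
  have herase : (T + s • unityRoots F m).erase 0 = univ.erase 0 :=
    eq_of_subset_of_card_le (erase_subset_erase 0 (subset_univ _)) (by
      rwa [card_erase_of_mem (mem_univ _), card_univ, hd, Nat.add_sub_cancel, mul_comm])
  exact mem_of_mem_erase (herase ▸ mem_erase.mpr ⟨hx, mem_univ x⟩)

end SumsetGrowth

section CoefficientSums

open Polynomial Finset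

theorem sum_range_coeff_eq_zero_of_X_pow_sub_one_dvd {R : Type*} [CommRing R] {m j N : ℕ}
    (hj : j < m) {P : R[X]} (hdvd : X ^ m - 1 ∣ P) (hP : P.natDegree < N * m) :
    ∑ i ∈ range N, P.coeff (i * m + j) = 0 := by
  nontriviality R
  obtain ⟨Q, rfl⟩ := hdvd
  rcases eq_or_ne Q 0 with rfl | hQ
  · simp
  have htelescope (N : ℕ) :
      ∑ i ∈ range (N + 1), ((X ^ m - 1) * Q).coeff (i * m + j) = -Q.coeff (N * m + j) := by
    induction N with
    | zero => simp [sub_mul, coeff_X_pow_mul', hj]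
    | succ N ih =>
      rw [sum_range_succ, ih, sub_mul, one_mul, coeff_sub,
        show (N + 1) * m + j = N * m + j + m by ring, coeff_X_pow_mul]
      ring
  cases N with
  | zero => simp
  | succ N =>
    rw [htelescope, coeff_eq_zero_of_natDegree_lt, neg_zero]
    by_contra! hle
    rw [← C_1, (monic_X_pow_sub_C 1 (by lia)).natDegree_mul' hQ, natDegree_X_pow_sub_C,
      Nat.succ_mul] at hP
    lia

theorem X_pow_sub_one_dvd_of_eval_eq_zero {R : Type*} [Field R] {m : ℕ} (hm : 0 < m)
    {ζ : R} (hζ : IsPrimitiveRoot ζ m) {P : R[X]} (hP : ∀ h, h ^ m = 1 → P.eval h = 0) :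
    X ^ m - 1 ∣ P := by
  rw [X_pow_sub_one_eq_prod hm hζ]
  exact prod_dvd_of_coprime ((pairwise_coprime_X_sub_C Function.injective_id).set_pairwise _)
    fun h hh ↦ dvd_iff_isRoot.mpr (hP h ((mem_nthRootsFinset hm 1).mp hh))

theorem cast_choose_succ_mul_succ {R : Type*} [CommRing R] (n k : ℕ) :
    (n.choose (k + 1) : R) * (k + 1) = n.choose k * (n - k) := by
  rcases le_or_gt k n with hk | hk
  · have h := congrArg (Nat.cast (R := R)) (Nat.choose_succ_right_eq n k)
    push_cast [hk] at h
    exact h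
  · rw [Nat.choose_eq_zero_of_lt hk, Nat.choose_eq_zero_of_lt (by lia)]
    simp

variable {F : Type*} [Field F] {m : ℕ} {ζ u : F}

/- The coefficient of `X ^ j` in `((X + 1) ^ m - 1) * ((X + 1) ^ m - u)` reduced modulo
`X ^ m - 1`: the product vanishes at every `m`-th root of unity. -/
theorem sum_choose_two_mul_sub_sum_choose_eq [NeZero m] (hζ : IsPrimitiveRoot ζ m)
    (hu : ∀ h : F, h ^ m = 1 → (h + 1) ^ m = 1 ∨ (h + 1) ^ m = u) {j : ℕ} (hj : j < m) :
    ∑ i ∈ range 3, ((2 * m).choose (i * m + j) : F) -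
      (1 + u) * ∑ i ∈ range 3, (m.choose (i * m + j) : F) + (if j = 0 then u else 0) = 0 := by
  have hdvd : X ^ m - 1 ∣ (X + 1 : F[X]) ^ (2 * m) - C (1 + u) * (X + 1) ^ m + C u :=
    X_pow_sub_one_dvd_of_eval_eq_zero (NeZero.pos m) hζ fun h hh ↦ by
      have hroot : ((h + 1) ^ m - 1) * ((h + 1) ^ m - u) = 0 := by
        simpa only [mul_eq_zero, sub_eq_zero] using hu h hh
      simp only [eval_add, eval_sub, eval_mul, eval_pow, eval_C, eval_X, eval_one]
      linear_combination hroot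
  have hdegree (n : ℕ) : ((X + 1 : F[X]) ^ n).natDegree = n := by
    rw [← C_1, natDegree_pow_X_add_C]
  have hdeg : ((X + 1 : F[X]) ^ (2 * m) - C (1 + u) * (X + 1) ^ m + C u).natDegree < 3 * m := by
    rw [natDegree_add_C]
    refine (natDegree_sub_le_of_le (hdegree _).le ((natDegree_C_mul_le _ _).trans
      (hdegree m).le)).trans_lt ?_
    have := NeZero.pos m
    lia
  have hsum := sum_range_coeff_eq_zero_of_X_pow_sub_one_dvd hj hdvd hdeg
  have hC : ∑ i ∈ range 3, (C u).coeff (i * m + j) = if j = 0 then u else 0 := by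
    simp [sum_range_succ, coeff_C, NeZero.ne m]
  simpa only [coeff_add, coeff_sub, coeff_C_mul, coeff_X_add_one_pow, sum_add_distrib,
    sum_sub_distrib, ← mul_sum, hC] using hsum

theorem eq_neg_one_of_choose_eq (hmF : (m : F) ≠ 0) (h2 : (2 : F) ≠ 0) (hu0 : u ≠ 0)
    (hcentral : ((2 * m).choose m : F) = u)
    (hfirst : 2 * m + ((2 * m).choose (m + 1) : F) = (1 + u) * m)
    (hsecond : ((2 * m).choose 2 + (2 * m).choose (m + 2) : F) = (1 + u) * m.choose 2) :
    u = -1 := by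
  have hchoose (n : ℕ) : (n.choose 2 : F) * 2 = n * (n - 1) := by
    simpa [one_add_one_eq_two] using cast_choose_succ_mul_succ (R := F) n 1
  have hchoose_two := hchoose (2 * m)
  have hcentral_succ := cast_choose_succ_mul_succ (R := F) (2 * m) m
  have hcentral_add_two := cast_choose_succ_mul_succ (R := F) (2 * m) (m + 1)
  push_cast at hchoose_two hcentral_succ hcentral_add_two
  rw [hcentral] at hcentral_succ
  have hum : u * m = m + 1 := by
    refine mul_left_cancel₀ hmF ?_
    linear_combination hcentral_succ - (m + 1 : F) * hfirst
  have hm1 : (m : F) + 1 ≠ 0 := hum ▸ mul_ne_zero hu0 hmF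
  have hcentral_succ_one : ((2 * m).choose (m + 1) : F) = 1 := by
    linear_combination hfirst + hum
  have hprod : (m : F) * (m * ((m + 1) * (2 * m + 1))) = 0 := by
    linear_combination 2 * m * (m + 2) * hsecond - m * (m + 2) * hchoose_two -
      2 * m * (hcentral_add_two + (m - 1 : F) * hcentral_succ_one) +
      (1 + u) * m * (m + 2) * hchoose m + m * (m - 1) * (m + 2) * hum
  have h2m : 2 * (m : F) + 1 = 0 := by simpa [hmF, hm1] using hprod
  refine mul_left_cancel₀ hmF (mul_left_cancel₀ h2 ?_)
  linear_combination 2 * hum + 2 * h2m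

theorem eq_neg_one_of_forall_add_one_pow [NeZero m] (hζ : IsPrimitiveRoot ζ m) (hm : 3 ≤ m)
    (h2 : (2 : F) ≠ 0) (hu0 : u ≠ 0)
    (hu : ∀ h : F, h ^ m = 1 → (h + 1) ^ m = 1 ∨ (h + 1) ^ m = u) : u = -1 := by
  have hvanish {n i : ℕ} (h : n < i) : (n.choose i : F) = 0 := by
    rw [Nat.choose_eq_zero_of_lt h, Nat.cast_zero]
  refine eq_neg_one_of_choose_eq (hζ.neZero' (R := F)).out h2 hu0 ?_ ?_ ?_
  · have h := sum_choose_two_mul_sub_sum_choose_eq hζ hu (j := 0) (by lia)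
    simp only [sum_range_succ, range_one, sum_singleton, zero_mul, one_mul, add_zero,
      Nat.choose_zero_right, Nat.choose_self, Nat.cast_one, hvanish (show m < 2 * m by lia),
      if_true] at h
    linear_combination h
  · have h := sum_choose_two_mul_sub_sum_choose_eq hζ hu (j := 1) (by lia)
    simp only [sum_range_succ, range_one, sum_singleton, zero_mul, zero_add, one_mul, add_zero,
      Nat.choose_one_right, Nat.cast_mul, Nat.cast_ofNat, hvanish (show m < m + 1 by lia),
      hvanish (show m < 2 * m + 1 by lia), hvanish (show 2 * m < 2 * m + 1 by lia),
      one_ne_zero, if_false] at h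
    linear_combination h
  · have h := sum_choose_two_mul_sub_sum_choose_eq hζ hu (j := 2) (by lia)
    simp only [sum_range_succ, range_one, sum_singleton, zero_mul, zero_add, one_mul, add_zero,
      hvanish (show m < m + 2 by lia), hvanish (show m < 2 * m + 2 by lia),
      hvanish (show 2 * m < 2 * m + 2 by lia), two_ne_zero, if_false] at h
    linear_combination h

end CoefficientSums

section ZeroSum

open Finset
open scoped Pointwise

variable {F : Type*} [Field F] [DecidableEq F] {m : ℕ} {ζ : F}

theorem pow_eq_one_or_eq_of_card_erase_zero_lt [NeZero m] (hζ : IsPrimitiveRoot ζ m)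
    {T : Finset F} (hT : unityRoots F m * T ⊆ T) (hone : 1 ∈ T) (hcard : #(T.erase 0) < 3 * m)
    {x y : F} (hx : x ∈ T.erase 0) (hxm : x ^ m ≠ 1) (hy : y ∈ T.erase 0) :
    y ^ m = 1 ∨ y ^ m = x ^ m := by
  rw [card_erase_zero_eq_card_image_pow_mul hζ hT] at hcard
  have hle : #((T.erase 0).image (· ^ m)) ≤ #{1, x ^ m} := by
    rw [card_pair hxm.symm]
    exact Nat.lt_succ_iff.mp (lt_of_mul_lt_mul_right hcard (Nat.zero_le m))
  have hpowone : 1 ∈ (T.erase 0).image (· ^ m) :=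
    mem_image.mpr ⟨1, mem_erase.mpr ⟨one_ne_zero, hone⟩, one_pow m⟩
  have hpair : {1, x ^ m} = (T.erase 0).image (· ^ m) :=
    eq_of_subset_of_card_le (insert_subset hpowone
      (singleton_subset_iff.mpr (mem_image_of_mem (· ^ m) hx))) hle
  have hmem : y ^ m ∈ ({1, x ^ m} : Finset F) := hpair ▸ mem_image_of_mem (· ^ m) hy
  simpa only [mem_insert, mem_singleton] using hmem

theorem exists_zero_mem_nsmul_unityRoots [NeZero m] (hζ : IsPrimitiveRoot ζ m) (hm : 3 ≤ m)
    (hcard : #((insert 0 (unityRoots F m) + insert 0 (unityRoots F m)).erase 0) < 3 * m) :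
    ∃ N, 0 < N ∧ N ≤ 3 ∧ (0 : F) ∈ N • unityRoots F m := by
  have hmem (x : F) : x ∈ unityRoots F m ↔ x ^ m = 1 :=
    Polynomial.mem_nthRootsFinset (NeZero.pos m) 1
  have hone : (1 : F) ∈ unityRoots F m := (hmem 1).mpr (one_pow m)
  by_cases hneg : (-1 : F) ∈ unityRoots F m
  · refine ⟨2, two_pos, by lia, ?_⟩
    rw [two_nsmul, ← neg_add_cancel (1 : F)]
    exact add_mem_add hneg hone
  have h2 : (2 : F) ≠ 0 := fun h ↦ hneg (by rwa [show (-1 : F) = 1 by linear_combination -h])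
  have hstable := unityRoots_mul_insert_zero_subset (unityRoots_mul_self_subset (F := F) (m := m))
  have hadd {h : F} (hh : h ^ m = 1) :
      h + 1 ∈ (insert 0 (unityRoots F m) + insert 0 (unityRoots F m)).erase 0 := by
    refine mem_erase.mpr ⟨fun h0 ↦ hneg (eq_neg_of_add_eq_zero_left h0 ▸ (hmem h).mpr hh), ?_⟩
    exact add_mem_add (mem_insert_of_mem ((hmem h).mpr hh)) (mem_insert_of_mem hone)
  obtain ⟨h₀, hh₀, hne⟩ : ∃ h : F, h ^ m = 1 ∧ (h + 1) ^ m ≠ 1 := by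
    by_contra! hall
    have := eq_neg_one_of_forall_add_one_pow hζ hm h2 one_ne_zero fun h hh ↦ .inl (hall h hh)
    exact h2 (by linear_combination this)
  have honeT : (1 : F) ∈ insert 0 (unityRoots F m) + insert 0 (unityRoots F m) :=
    zero_add (1 : F) ▸ add_mem_add (mem_insert_self _ _) (mem_insert_of_mem hone)
  have hpow : (h₀ + 1) ^ m = -1 :=
    eq_neg_one_of_forall_add_one_pow hζ hm h2 (pow_ne_zero m (ne_of_mem_erase (hadd hh₀)))
      fun h hh ↦ pow_eq_one_or_eq_of_card_erase_zero_lt hζ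
        (unityRoots_mul_add_subset hstable hstable) honeT hcard (hadd hh₀) hne (hadd hh)
  have hodd : Odd m := by
    by_contra heven
    exact hneg ((hmem _).mpr (Nat.not_odd_iff_even.mp heven).neg_one_pow)
  have hneg_mem : -(h₀ + 1) ∈ unityRoots F m := (hmem _).mpr (by rw [hodd.neg_pow, hpow, neg_neg])
  refine ⟨3, three_pos, le_rfl, ?_⟩
  rw [succ_nsmul, two_nsmul, ← add_neg_cancel (h₀ + 1)]
  exact add_mem_add (add_mem_add ((hmem h₀).mpr hh₀) hone) hneg_mem

theorem zero_mem_add_add_nsmul_of_zero_mem_nsmul {H : Finset F} {N : ℕ} (hN : 0 < N) (hN3 : N ≤ 3)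
    (hzero : (0 : F) ∈ N • H) (s : ℕ) : (0 : F) ∈ insert 0 H + insert 0 H + s • H := by
  obtain ⟨e, he, hdvd⟩ : ∃ e ≤ 2, N ∣ e + s := by
    refine ⟨(N - s % N) % N, Nat.le_of_lt_succ ((Nat.mod_lt _ hN).trans_le hN3), ?_⟩
    rw [Nat.dvd_iff_mod_eq_zero, Nat.mod_add_mod, ← Nat.add_mod_mod,
      Nat.sub_add_cancel (Nat.mod_lt s hN).le, Nat.mod_self]
  have hes : (0 : F) ∈ e • H + s • H := by
    obtain ⟨c, hc⟩ := hdvd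
    rw [← add_nsmul, hc, mul_nsmul, ← nsmul_zero c]
    exact nsmul_mem_nsmul hzero
  have he_subset : e • H ⊆ insert 0 H + insert 0 H := by
    rw [← two_nsmul]
    exact nsmul_subset_nsmul (subset_insert 0 H) (mem_insert_self 0 H) he
  exact add_subset_add_right he_subset hes

theorem insert_zero_add_insert_zero_add_nsmul_unityRoots_eq_univ [Fintype F] [NeZero m]
    (hζ : IsPrimitiveRoot ζ m) (hm : 3 ≤ m)
    (hgen : AddSubmonoid.closure (unityRoots F m : Set F) = ⊤) {d s : ℕ}
    (hd : Fintype.card F = m * d + 1) (hs : d ≤ s + 2) :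
    insert 0 (unityRoots F m) + insert 0 (unityRoots F m) + s • unityRoots F m = univ := by
  have hone : (1 : F) ∈ unityRoots F m := Polynomial.one_mem_nthRootsFinset (NeZero.pos m)
  have hstable := unityRoots_mul_insert_zero_subset (unityRoots_mul_self_subset (F := F) (m := m))
  refine eq_univ_of_forall fun x ↦ ?_
  rcases ne_or_eq x 0 with hx | rfl
  · have hmem := mem_add_nsmul_unityRoots_of_ne_zero hζ hm hgen (mul_zero_subset _)
      zero_nonempty (c := 0) hd (by lia) (by lia : d ≤ 0 + (2 + s)) hx
    rw [zero_add, add_nsmul, two_nsmul] at hmem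
    exact add_subset_add_right (add_subset_add (subset_insert _ _) (subset_insert _ _)) hmem
  rcases lt_or_ge #((insert 0 (unityRoots F m) + insert 0 (unityRoots F m)).erase 0) (3 * m)
    with hsmall | hlarge
  · obtain ⟨N, hN, hN3, hzero⟩ := exists_zero_mem_nsmul_unityRoots hζ hm hsmall
    exact zero_mem_add_add_nsmul_of_zero_mem_nsmul hN hN3 hzero s
  cases s with
  | zero =>
    rw [zero_nsmul, add_zero]
    simpa only [add_zero] using add_mem_add (mem_insert_self (0 : F) (unityRoots F m))
      (mem_insert_self (0 : F) (unityRoots F m))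
  | succ r =>
    have hneg_one := mem_add_nsmul_unityRoots_of_ne_zero hζ hm hgen
      (unityRoots_mul_add_subset hstable hstable)
      ((insert_nonempty _ _).add (insert_nonempty _ _)) hd hlarge (by lia : d ≤ 3 + r)
      (neg_ne_zero.mpr one_ne_zero)
    have hmem := add_mem_add hneg_one hone
    rwa [neg_add_cancel, add_assoc, ← succ_nsmul] at hmem

end ZeroSum

section PowersOfFiniteFields

variable {F : Type*} [Field F]

theorem exists_isPrimitiveRoot_card_sub_one [Finite F] :
    ∃ g : F, IsPrimitiveRoot g (Nat.card F - 1) := by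
  obtain ⟨u, hu⟩ := IsCyclic.exists_ofOrder_eq_natCard (α := Fˣ)
  rw [Nat.card_units] at hu
  exact ⟨u, IsPrimitiveRoot.coe_units_iff.mpr (hu ▸ IsPrimitiveRoot.orderOf u)⟩

theorem kPowers_eq_insert_zero_unityRoots [Finite F] {k m : ℕ} (hk : k ≠ 0)
    (hcard : Nat.card F - 1 = m * k.gcd (Nat.card F - 1)) :
    kPowers k F = insert 0 (unityRoots F m : Set F) := by
  have := Fintype.ofFinite F
  have hpos : 0 < Nat.card F - 1 := Nat.sub_pos_of_lt Finite.one_lt_card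
  have hm : 0 < m := Nat.pos_of_mul_pos_right (hcard ▸ hpos)
  have : NeZero m := ⟨hm.ne'⟩
  ext x
  rw [Set.mem_insert_iff, Finset.mem_coe, Polynomial.mem_nthRootsFinset hm]
  constructor
  · rintro ⟨a, rfl⟩
    rcases eq_or_ne a 0 with rfl | ha
    · exact Or.inl (zero_pow hk)
    · obtain ⟨c, hc⟩ := Nat.gcd_dvd_left k (Nat.card F - 1)
      refine Or.inr ?_
      rw [← pow_mul, hc, mul_right_comm, mul_comm _ m, ← hcard, Nat.card_eq_fintype_card, pow_mul,
        FiniteField.pow_card_sub_one_eq_one a ha, one_pow]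
  · rintro (rfl | hx)
    · exact ⟨0, zero_pow hk⟩
    · obtain ⟨g, hg⟩ := exists_isPrimitiveRoot_card_sub_one (F := F)
      obtain ⟨i, -, rfl⟩ := (hg.pow hpos (hcard.trans (mul_comm _ _))).eq_pow_of_pow_eq_one hx
      obtain ⟨b, hb⟩ := exists_pow_eq_pow_gcd_card_sub_one hk (g ^ i)
      exact ⟨b, by rw [hb, pow_right_comm]⟩

theorem closure_kPowers_eq_top [Finite F] {p k ℓ : ℕ} (hℓ : IsPowerSumExponent p k F ℓ)
    (hF : Nat.card F = p ^ ℓ) : AddSubmonoid.closure (kPowers k F) = ⊤ := by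
  obtain ⟨K, hK, hsums⟩ := hℓ
  have huniv : (K : Set F) = Set.univ :=
    (Set.eq_univ_iff_ncard _).mpr (hK.trans hF.symm)
  refine eq_top_iff.mpr fun x _ ↦ ?_
  have hx : x ∈ ⋃ s ≥ 1, sumset s (kPowers k F) := hsums.trans huniv ▸ Set.mem_univ x
  obtain ⟨s, -, f, hf, rfl⟩ := Set.mem_iUnion₂.mp hx
  exact sum_mem fun i _ ↦ AddSubmonoid.subset_closure (hf i)

end PowersOfFiniteFields

theorem twoPowerSums_eq_univ_iff {F : Type*} [Field F] {k n : ℕ} :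
    twoPowerSums k n F = Set.univ ↔
      ∀ M : Matrix (Fin n) (Fin n) F, ∃ A B, A ^ k + B ^ k = M := by
  rw [Set.eq_univ_iff_forall]
  refine forall_congr' fun M ↦ ⟨?_, ?_⟩
  · rintro ⟨f, hf, rfl⟩
    obtain ⟨A, hA⟩ := hf 0
    obtain ⟨B, hB⟩ := hf 1
    exact ⟨A, B, by rw [hA, hB, Fin.sum_univ_two]⟩
  · rintro ⟨A, B, rfl⟩
    exact ⟨![A ^ k, B ^ k], Fin.forall_fin_two.mpr ⟨⟨A, rfl⟩, ⟨B, rfl⟩⟩, Fin.sum_univ_two _⟩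

section TwoPowerSums

open Finset
open scoped Pointwise

variable {F : Type*} [Field F] [DecidableEq F]

theorem exists_sum_pow_eq_of_mem_insert_zero_add_nsmul {k s : ℕ} (hk : k ≠ 0) {H : Finset F}
    (hH : (H : Set F) ⊆ kPowers k F) (hzero : 0 ∉ H) {y : F} (hy : y ∈ insert 0 H + s • H) :
    ∃ a : Fin (s + 1) → F, {i | a i = 0}.Subsingleton ∧ ∑ i, a i ^ k = y := by
  obtain ⟨x, hx, _, hz, rfl⟩ := mem_add.mp hy
  obtain ⟨h, rfl⟩ := mem_nsmul.mp hz
  obtain ⟨a, rfl⟩ : x ∈ kPowers k F := by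
    rcases mem_insert.mp hx with rfl | hx
    · exact ⟨0, zero_pow hk⟩
    · exact hH hx
  choose b hb using fun i ↦ hH (h i).2
  have hb0 (i : Fin s) : b i ≠ 0 := fun h0 ↦
    hzero (by simpa only [← hb, h0, zero_pow hk] using (h i).2)
  have hsupport (i : Fin (s + 1)) (hi : (Fin.cons a b : Fin (s + 1) → F) i = 0) : i = 0 := by
    cases i using Fin.cases with
    | zero => rfl
    | succ i => exact absurd hi (hb0 i)
  refine ⟨Fin.cons a b, fun i hi j hj ↦ (hsupport i hi).trans (hsupport j hj).symm, ?_⟩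
  simp only [Fin.sum_univ_succ, Fin.cons_zero, Fin.cons_succ, hb, List.sum_ofFn]

theorem twoPowerSums_eq_univ_of_insert_zero_add_eq_univ [Fintype F] {k t : ℕ} (hk : (k : F) ≠ 0)
    (hscalar : ∀ c : F, ∃ A B : Matrix (Fin (t + 1)) (Fin (t + 1)) F,
      A ^ k + B ^ k = Matrix.scalar (Fin (t + 1)) c)
    {H : Finset F} (hH : (H : Set F) ⊆ kPowers k F) (hzero : 0 ∉ H)
    (hsum : insert 0 H + insert 0 H + (2 * t) • H = univ) :
    twoPowerSums k (t + 1) F = Set.univ := by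
  refine twoPowerSums_eq_univ_iff.mpr fun M ↦ ?_
  by_cases hM : ∃ c, M = Matrix.scalar (Fin (t + 1)) c
  · obtain ⟨c, rfl⟩ := hM
    exact hscalar c
  have hk0 : k ≠ 0 := by
    rintro rfl
    exact hk Nat.cast_zero
  rw [two_mul, add_nsmul, add_add_add_comm] at hsum
  obtain ⟨y, hy, z, hz, hyz⟩ := mem_add.mp (hsum ▸ mem_univ M.trace)
  obtain ⟨a, ha, rfl⟩ := exists_sum_pow_eq_of_mem_insert_zero_add_nsmul hk0 hH hzero hy
  obtain ⟨b, hb, rfl⟩ := exists_sum_pow_eq_of_mem_insert_zero_add_nsmul hk0 hH hzero hz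
  exact exists_pow_add_pow_eq_of_trace_eq hk (not_exists.mp hM) ha hb hyz

theorem insert_zero_add_nsmul_unityRoots_eq_univ [Fintype F] {m s : ℕ} {ζ : F} [NeZero m]
    (hζ : IsPrimitiveRoot ζ m) (hm : 2 ≤ m)
    (hgen : AddSubmonoid.closure (unityRoots F m : Set F) = ⊤)
    (hcard : Fintype.card F ≤ m + 1 + s) :
    insert 0 (unityRoots F m) + s • unityRoots F m = univ := by
  have hzero : (0 : F) ∉ unityRoots F m := fun h ↦
    Polynomial.ne_zero_of_mem_nthRootsFinset one_ne_zero h rfl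
  have hgrowth := min_card_add_le_card_add_nsmul (hζ.ne_one hm)
    (fun h hh ↦ unityRoots_mul_self_subset
      (mul_mem_mul (hζ.mem_nthRootsFinset (NeZero.pos m)) hh))
    hgen (insert_nonempty 0 (unityRoots F m)) s
  rw [card_insert_of_notMem hzero, hζ.card_nthRootsFinset, min_eq_right hcard] at hgrowth
  exact (card_eq_iff_eq_univ _).mp (le_antisymm (card_le_univ _) hgrowth)

theorem insert_zero_add_add_nsmul_unityRoots_eq_univ_of_card [Fintype F] {d m n : ℕ} {ζ : F}
    [NeZero m] (hζ : IsPrimitiveRoot ζ m)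
    (hgen : AddSubmonoid.closure (unityRoots F m : Set F) = ⊤)
    (hm : Fintype.card F = m * d + 1) (hd : 0 < d)
    (h : 3 * d + 1 ≤ Fintype.card F ∧ d ≤ 2 * (n + 1) ∨
      Fintype.card F = 2 * d + 1 ∧ d ≤ n + 1) :
    insert 0 (unityRoots F m) + insert 0 (unityRoots F m) + (2 * n) • unityRoots F m = univ := by
  rcases h with ⟨hcard, hdn⟩ | ⟨hcard, hdn⟩
  · have hm3 : 3 ≤ m := le_of_mul_le_mul_right (by lia : 3 * d ≤ m * d) hd
    exact insert_zero_add_insert_zero_add_nsmul_unityRoots_eq_univ hζ hm3 hgen hm hdn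
  · have hm2 : 2 = m := Nat.eq_of_mul_eq_mul_right hd (by lia : 2 * d = m * d)
    refine univ_subset_iff.mp ?_
    rw [← insert_zero_add_nsmul_unityRoots_eq_univ hζ hm2.le hgen (s := 2 * n) (by lia)]
    exact add_subset_add_right (subset_add_left _ (mem_insert_self 0 _))

end TwoPowerSums

theorem exists_dvd_and_gcd_sub_one_pow_four_lt {k q n : ℕ} (hk : k ≠ 0) (hq : 1 < q)
    (h : k.gcd (q - 1) = 2 ∨ 2 < k.gcd (q - 1) ∧
      4 * Real.log ((k : ℝ) - 1) / Real.log (q : ℝ) < n) :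
    ∃ r, r ∣ n ∧ (k.gcd (q ^ r - 1) - 1) ^ 4 < q ^ r := by
  rcases h with hd | ⟨hd, hlog⟩
  · exact ⟨1, one_dvd n, by rwa [pow_one, hd, Nat.add_one_sub_one, one_pow]⟩
  have hk2 : 2 < k := hd.trans_le (Nat.gcd_le_left _ (Nat.pos_of_ne_zero hk))
  have hkpos : 0 < ((k - 1 : ℕ) : ℝ) := by exact_mod_cast (by lia : 0 < k - 1)
  rw [div_lt_iff₀ (Real.log_pos (by exact_mod_cast hq)), ← Nat.cast_pred (by lia)] at hlog
  have hpow : ((k - 1 : ℕ) : ℝ) ^ 4 < (q : ℝ) ^ n := by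
    rw [← Real.log_lt_log_iff (by positivity) (by positivity), Real.log_pow, Real.log_pow]
    exact_mod_cast hlog
  refine ⟨n, dvd_rfl, ?_⟩
  calc (k.gcd (q ^ n - 1) - 1) ^ 4 ≤ (k - 1) ^ 4 := by
        gcongr; exact Nat.gcd_le_left _ (Nat.pos_of_ne_zero hk)
    _ < q ^ n := by exact_mod_cast hpow

theorem theorem1p16_general {F : Type*} [Field F] [Finite F] {k n r d : ℕ} (hk : (k : F) ≠ 0)
    (hgen : AddSubmonoid.closure (kPowers k F) = ⊤) (hr : r ∣ n)
    (hkr : (k.gcd (Nat.card F ^ r - 1) - 1) ^ 4 < Nat.card F ^ r)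
    (hd : d = k.gcd (Nat.card F - 1))
    (h : 3 * d + 1 ≤ Nat.card F ∧ d ≤ 2 * n ∨ Nat.card F = 2 * d + 1 ∧ d ≤ n) :
    twoPowerSums k n F = Set.univ := by
  classical
  have := Fintype.ofFinite F
  have hk0 : k ≠ 0 := fun h0 ↦ hk (h0 ▸ Nat.cast_zero)
  have hdpos : 0 < d := hd ▸ Nat.gcd_pos_of_pos_left _ (Nat.pos_of_ne_zero hk0)
  have hcard : 1 < Nat.card F := Finite.one_lt_card
  obtain ⟨t, rfl⟩ : ∃ t, n = t + 1 := ⟨n - 1, by lia⟩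
  obtain ⟨m, hm⟩ : d ∣ Nat.card F - 1 := hd ▸ Nat.gcd_dvd_right _ _
  have : NeZero m := ⟨by rintro rfl; lia⟩
  have hpowers : kPowers k F = insert 0 (unityRoots F m : Set F) :=
    kPowers_eq_insert_zero_unityRoots hk0 (by rw [← hd, hm, mul_comm])
  rw [hpowers, AddSubmonoid.closure_insert_zero] at hgen
  obtain ⟨g, hg⟩ := exists_isPrimitiveRoot_card_sub_one (F := F)
  refine twoPowerSums_eq_univ_of_insert_zero_add_eq_univ hk
    (exists_pow_add_pow_eq_scalar_of_dvd hk0 t.succ_ne_zero hr hkr)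
    (hpowers ▸ Set.subset_insert 0 _)
    (fun h0 ↦ Polynomial.ne_zero_of_mem_nthRootsFinset one_ne_zero h0 rfl) ?_
  rw [Nat.card_eq_fintype_card] at h hm hcard hg
  exact insert_zero_add_add_nsmul_unityRoots_eq_univ_of_card (hg.pow (by lia) hm) hgen
    (by lia) hdpos h

theorem natCast_ne_zero_of_card_eq_prime_pow {F : Type*} [Field F] [Finite F] {p l k : ℕ}
    (hp : p.Prime) (hF : Nat.card F = p ^ l) (hpk : ¬ p ∣ k) : (k : F) ≠ 0 := by
  have := Fintype.ofFinite F
  have : Fact p.Prime := ⟨hp⟩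
  have := charP_of_card_eq_prime_pow (Nat.card_eq_fintype_card.symm.trans hF)
  exact mt (CharP.cast_eq_zero_iff F p k).mp hpk

theorem theorem1p16 (p l q k n d ℓ : ℕ) (hp : p.Prime) (hl : 1 ≤ l) (hq : q = p ^ l)
    (hk : 1 ≤ k) (hn : 2 ≤ n)
    (F : Type*) [Field F] [Finite F] (hF : Nat.card F = q)
    (hd : d = Nat.gcd k (q - 1))
    (hℓ : IsPowerSumExponent p k F ℓ) (hℓl : ℓ = l) (hpk : ¬ p ∣ k) :
    (3 * d + 1 ≤ q →
      (d = 2 ∨ (2 < d ∧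
        max (((d : ℝ) - 1) / 2) (4 * Real.log ((k : ℝ) - 1) / Real.log (q : ℝ)) < (n : ℝ))) →
      twoPowerSums k n F = Set.univ) ∧
    (q = 2 * d + 1 →
      (d = 2 ∨ (2 < d ∧
        max (2 * (d : ℝ) - 1) (4 * Real.log ((k : ℝ) - 1) / Real.log (q : ℝ)) < (n : ℝ))) →
      twoPowerSums k n F = Set.univ) := by
  subst hℓl hF
  have hkF : (k : F) ≠ 0 := natCast_ne_zero_of_card_eq_prime_pow hp hq hpk
  have hgen := closure_kPowers_eq_top hℓ hq
  have hscalar (h : d = 2 ∨ 2 < d ∧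
      4 * Real.log ((k : ℝ) - 1) / Real.log (Nat.card F : ℝ) < n) :=
    exists_dvd_and_gcd_sub_one_pow_four_lt (Nat.ne_of_gt hk) Finite.one_lt_card (hd ▸ h)
  simp only [max_lt_iff]
  refine ⟨fun hcard h ↦ ?_, fun hcard h ↦ ?_⟩
  · obtain ⟨r, hr, hkr⟩ := hscalar (h.imp_right (And.imp_right And.right))
    refine theorem1p16_general hkF hgen hr hkr hd (Or.inl ⟨hcard, ?_⟩)
    rcases h with rfl | ⟨-, hdn, -⟩
    · lia
    · have : (d : ℝ) < 2 * n + 1 := by linarith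
      exact Nat.lt_succ_iff.mp (by exact_mod_cast this)
  · obtain ⟨r, hr, hkr⟩ := hscalar (h.imp_right (And.imp_right And.right))
    refine theorem1p16_general hkF hgen hr hkr hd (Or.inr ⟨hcard, ?_⟩)
    rcases h with rfl | ⟨-, hdn, -⟩
    · exact hn
    · have : 2 * (d : ℝ) < n + 1 := by linarith
      have : 2 * d < n + 1 := by exact_mod_cast this
      lia
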